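/- Throughout, C*-algebras are complex and unital, and $A\otimes B$ denotes the (completed) spatial tensor product of C*-algebras. A *state* on $A$ is a positive linear functional $\mu$ on $A$ with $\mu(1)=1$; $\mu\otimes\nu$ denotes the product state on $A\otimes B$, determined by $(\mu\otimes\nu)(a\otimes b)=\mu(a)\nu(b)$. Let $X$ be a set, $\{A_x\}_{x\in X}$ a family of C*-algebras, and let $D$ assign to each pair $(x,x')\in X\times X$ an element $D_{x,x'}\in A_x\otimes A_{x'}$. A *family of metric-states* for $D$ is a family $\{\mu_x\}_{x\in X}$, with $\mu_x$ a state on $A_x$, such that $(\mu_x\otimes\mu_x)(D_{x,x})=0$ for every $x$. Call $D$ a *metric operator field* (mof) if 1. $D$ has a family of metric-states; 2. for $x\ne x'$, $D_{x,x'}$ is a positive invertible element of $A_x\otimes A_{x'}$; 3. for all $x,x'$, $D_{x,x'}$ is the image of $D_{x',x}$ under the flip $A_{x'}\otimes A_x\to A_x\otimes A_{x'}$; 4. for all $x,x',x''$, in $A_x\otimes A_{x'}\otimes A_{x''}$ one has $M(D_{x,x''})\le D_{x,x'}\otimes 1+1\otimes D_{x',x''}$, where $M$ is the $*$-homomorphism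 $A_x\otimes A_{x''}\to A_x\otimes A_{x'}\otimes A_{x''}$, $a\otimes c\mapsto a\otimes 1\otimes c$. For a positive element $a$ of a C*-algebra $A$ and a state $\mu$ on $A$ with GNS representation $\pi_\mu$ and cyclic vector $\xi_\mu$, let $P(a,\mu)$ be the Borel measure $G\mapsto\langle \xi_\mu,E(G)\xi_\mu\rangle$ on $[0,\infty)$, where $E$ is the spectral measure of $\pi_\mu(a)$. **Theorem.** Let $D$ be a metric operator field on $\{A_x\}_{x\in X}$ and let $\{\mu_x\}$ be any family of metric-states for $D$. Then every $D_{x,x'}$ (including $x=x'$) is positive, so that $P_{x,x'}:=P(D_{x,x'},\mu_x\otimes\mu_{x'})$ is defined for all $x,x'\in X$, and $(X,\{P_{x,x'}\})$ is a probabilistic metric space in the sense of Schweizer–Sklar, i.e. every $P_{x,x'}$ is a Borel probability measure on $[0,\infty)$ and - (i) $P_{x,x}=\delta_0$, the point mass at $0$, for every $x$; - (ii) $P_{x,x'}\neq\delta_0$ for $x\ne x'$; - (iii) $P_{x,x'}=P_{x',x}$ for all $x,x'$; - (iv) for all $x,x',x''\in X$ and real $r,s\ge0$: if $P_{x,x'}[0,r]=1$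 and $P_{x',x''}[0,s]=1$, then $P_{x,x''}[0,r+s]=1$. -/

import Mathlib

open scoped TensorProduct ComplexOrder InnerProductSpace NNReal CompactlySupported
open MeasureTheory UniformSpace

noncomputable section

namespace MetricOperatorField

/-! ### Hilbert space tensor products -/

section Hilbert

variable {E F H K L : Type*}
  [NormedAddCommGroup E] [InnerProductSpace ℂ E]
  [NormedAddCommGroup F] [InnerProductSpace ℂ F]
  [NormedAddCommGroup H] [InnerProductSpace ℂ H]
  [NormedAddCommGroup K] [InnerProductSpace ℂ K]
  [NormedAddCommGroup L] [InnerProductSpace ℂ L]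

variable (H K) in
/-- The (completed) tensor product of two Hilbert spaces. -/
def HilbertTensor : Type _ := Completion (H ⊗[ℂ] K)

instance : NormedAddCommGroup (HilbertTensor H K) :=
  inferInstanceAs (NormedAddCommGroup (Completion (H ⊗[ℂ] K)))

instance : InnerProductSpace ℂ (HilbertTensor H K) :=
  inferInstanceAs (InnerProductSpace ℂ (Completion (H ⊗[ℂ] K)))

instance : CompleteSpace (HilbertTensor H K) :=
  inferInstanceAs (CompleteSpace (Completion (H ⊗[ℂ] K)))

variable (H K) in
/-- The inclusion of the algebraic tensor product in its completion. -/
def toHilbertTensor : H ⊗[ℂ] K →ₗᵢ[ℂ] HilbertTensor H K :=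
  (Completion.toComplₗᵢ : H ⊗[ℂ] K →ₗᵢ[ℂ] Completion (H ⊗[ℂ] K))

theorem denseRange_toHilbertTensor : DenseRange (toHilbertTensor H K) :=
  Completion.denseRange_coe (α := H ⊗[ℂ] K)

/-- The elementary tensor of two vectors in the completed tensor product. -/
def vecTensor (v : H) (w : K) : HilbertTensor H K := toHilbertTensor H K (v ⊗ₜ[ℂ] w)

/-- The tensor product `S ⊗ T` of two bounded operators, acting on the completed tensor product. -/
def opTensor (S : H →L[ℂ] H) (T : K →L[ℂ] K) : HilbertTensor H K →L[ℂ] HilbertTensor H K :=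
  ((TensorProduct.mapL S T).completion :
    Completion (H ⊗[ℂ] K) →L[ℂ] Completion (H ⊗[ℂ] K))

/-- The unitary between completed tensor products that extends a surjective linear isometry between
the algebraic ones. -/
def hilbertCongr (e : E ⊗[ℂ] F ≃ₗᵢ[ℂ] H ⊗[ℂ] K) : HilbertTensor E F ≃ₗᵢ[ℂ] HilbertTensor H K :=
  e.toLinearEquiv.extendOfIsometry
    (toHilbertTensor E F).toLinearMap (toHilbertTensor H K).toLinearMap
    denseRange_toHilbertTensor denseRange_toHilbertTensor (fun x => by simp)

variable (H K) in
/-- The flip `v ⊗ w ↦ w ⊗ v`. -/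
def hilbertSwap : HilbertTensor H K ≃ₗᵢ[ℂ] HilbertTensor K H :=
  hilbertCongr (TensorProduct.commIsometry ℂ H K)

/-- Images of dense isometries have a dense tensor product. -/
theorem denseRange_mapIsometry (f : E →ₗᵢ[ℂ] H) (g : F →ₗᵢ[ℂ] K)
    (hf : DenseRange f) (hg : DenseRange g) :
    DenseRange (TensorProduct.mapIsometry f g) := by
  set S : Submodule ℂ (H ⊗[ℂ] K) :=
    (LinearMap.range (TensorProduct.mapIsometry f g).toLinearMap).topologicalClosure with hS
  have key : ∀ (h : H) (k : K), h ⊗ₜ[ℂ] k ∈ S := by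
    intro h k
    have hd : DenseRange (Prod.map f g) := hf.prodMap hg
    refine hd.induction_on (p := fun q : H × K => q.1 ⊗ₜ[ℂ] q.2 ∈ S) (h, k) ?_ ?_
    · exact (Submodule.isClosed_topologicalClosure _).preimage TensorProduct.continuous_tmul
    · rintro ⟨a, b⟩
      exact Submodule.le_topologicalClosure _ ⟨a ⊗ₜ[ℂ] b, by simp⟩
  have htop : S = ⊤ := by
    rw [eq_top_iff, ← TensorProduct.span_tmul_eq_top ℂ H K, Submodule.span_le]
    rintro _ ⟨h, k, rfl⟩
    exact key h k
  intro x
  have hx : x ∈ S := htop ▸ Submodule.mem_top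
  exact hx

variable (H K L) in
/-- The canonical isometry of `(H ⊗ K) ⊗ L` (algebraic) into the iterated completion. -/
def toLeftTriple : (H ⊗[ℂ] K) ⊗[ℂ] L →ₗᵢ[ℂ] HilbertTensor (HilbertTensor H K) L :=
  (toHilbertTensor (HilbertTensor H K) L).comp
    (TensorProduct.mapIsometry (toHilbertTensor H K) LinearIsometry.id)

variable (H K L) in
/-- The canonical isometry of `H ⊗ (K ⊗ L)` (algebraic) into the iterated completion. -/
def toRightTriple : H ⊗[ℂ] (K ⊗[ℂ] L) →ₗᵢ[ℂ] HilbertTensor H (HilbertTensor K L) :=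
  (toHilbertTensor H (HilbertTensor K L)).comp
    (TensorProduct.mapIsometry LinearIsometry.id (toHilbertTensor K L))

theorem denseRange_toLeftTriple : DenseRange (toLeftTriple H K L) := by
  have h := DenseRange.comp (denseRange_toHilbertTensor (H := HilbertTensor H K) (K := L))
    (denseRange_mapIsometry (toHilbertTensor H K) (LinearIsometry.id (R := ℂ) (E := L))
      denseRange_toHilbertTensor denseRange_id)
    (toHilbertTensor (HilbertTensor H K) L).continuous
  exact h

theorem denseRange_toRightTriple : DenseRange (toRightTriple H K L) := by
  have h := DenseRange.comp (denseRange_toHilbertTensor (H := H) (K := HilbertTensor K L))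
    (denseRange_mapIsometry (LinearIsometry.id (R := ℂ) (E := H)) (toHilbertTensor K L)
      denseRange_id denseRange_toHilbertTensor)
    (toHilbertTensor H (HilbertTensor K L)).continuous
  exact h

variable (H K L) in
/-- The associativity isomorphism `(u ⊗ v) ⊗ w ↦ u ⊗ (v ⊗ w)` of Hilbert spaces. -/
def hilbertAssoc :
    HilbertTensor (HilbertTensor H K) L ≃ₗᵢ[ℂ] HilbertTensor H (HilbertTensor K L) :=
  (TensorProduct.assoc ℂ H K L).extendOfIsometry
    (toLeftTriple H K L).toLinearMap (toRightTriple H K L).toLinearMap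
    denseRange_toLeftTriple denseRange_toRightTriple (fun x => by
      exact ((toRightTriple H K L).norm_map _).trans
        ((TensorProduct.norm_assoc x).trans ((toLeftTriple H K L).norm_map x).symm))

variable (H K L) in
/-- The unitary `(u ⊗ v) ⊗ w ↦ (u ⊗ w) ⊗ v`. -/
def hilbertSwapRight :
    HilbertTensor (HilbertTensor H K) L ≃ₗᵢ[ℂ] HilbertTensor (HilbertTensor H L) K :=
  ((hilbertAssoc H K L).trans
    (hilbertCongr ((hilbertSwap K L).lTensor H))).trans (hilbertAssoc H L K).symm

/-- Conjugation `T ↦ U T U⁻¹` by a unitary. -/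
def conjBy (U : E ≃ₗᵢ[ℂ] F) (T : E →L[ℂ] E) : F →L[ℂ] F :=
  (U.toContinuousLinearEquiv : E →L[ℂ] F) ∘L T ∘L (U.symm.toContinuousLinearEquiv : F →L[ℂ] E)

/-- The flip of operators, `S ⊗ T ↦ T ⊗ S`. -/
def flipOp (T : HilbertTensor H K →L[ℂ] HilbertTensor H K) :
    HilbertTensor K H →L[ℂ] HilbertTensor K H :=
  conjBy (hilbertSwap H K) T

variable (L) in
/-- `T ↦ T ⊗ 1`, with `T` acting on the first two of three factors. -/
def leg12 (T : HilbertTensor H K →L[ℂ] HilbertTensor H K) :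
    HilbertTensor (HilbertTensor H K) L →L[ℂ] HilbertTensor (HilbertTensor H K) L :=
  opTensor T (ContinuousLinearMap.id ℂ L)

variable (H) in
/-- `T ↦ 1 ⊗ T`, with `T` acting on the last two of three factors. -/
def leg23 (T : HilbertTensor K L →L[ℂ] HilbertTensor K L) :
    HilbertTensor (HilbertTensor H K) L →L[ℂ] HilbertTensor (HilbertTensor H K) L :=
  conjBy (hilbertAssoc H K L).symm (opTensor (ContinuousLinearMap.id ℂ H) T)

variable (K) in
/-- The map that puts the unit in the middle, `R ⊗ T ↦ R ⊗ 1 ⊗ T`. -/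
def leg13 (T : HilbertTensor H L →L[ℂ] HilbertTensor H L) :
    HilbertTensor (HilbertTensor H K) L →L[ℂ] HilbertTensor (HilbertTensor H K) L :=
  conjBy (hilbertSwapRight H L K) (leg12 K T)

end Hilbert

/-! ### Direct sums of representations -/

section DirectSum

variable {A : Type*} [CStarAlgebra A] {ι : Type*} {G : ι → Type*}
  [∀ i, NormedAddCommGroup (G i)] [∀ i, InnerProductSpace ℂ (G i)] [∀ i, CompleteSpace (G i)]

theorem rep_apply_norm_le {H : Type*} [NormedAddCommGroup H] [InnerProductSpace ℂ H]
    [CompleteSpace H] (π : A →⋆ₐ[ℂ] (H →L[ℂ] H)) (a : A) (v : H) : ‖π a v‖ ≤ ‖a‖ * ‖v‖ :=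
  ((π a).le_opNorm v).trans
    (mul_le_mul_of_nonneg_right (NonUnitalStarAlgHom.norm_apply_le π a) (norm_nonneg _))

theorem memℓp_rep (π : ∀ i, A →⋆ₐ[ℂ] (G i →L[ℂ] G i)) (a : A) (v : lp G 2) :
    Memℓp (fun i => π i a (v i)) 2 := by
  have h : Memℓp (fun i => (‖a‖ : ℂ) • v i) 2 := (lp.memℓp v).const_smul (‖a‖ : ℂ)
  refine memℓp_gen ?_
  refine Summable.of_nonneg_of_le (fun _ => by positivity) (fun i => ?_) (h.summable (by simp))
  refine Real.rpow_le_rpow (norm_nonneg _) ?_ (by simp)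
  simpa [norm_smul] using rep_apply_norm_le (π i) a (v i)

/-- The operator of `a` in the direct sum of a family of representations: `a` acts componentwise. -/
def directSumOp (π : ∀ i, A →⋆ₐ[ℂ] (G i →L[ℂ] G i)) (a : A) : lp G 2 →L[ℂ] lp G 2 :=
  LinearMap.mkContinuous
    { toFun := fun v => ⟨fun i => π i a (v i), memℓp_rep π a v⟩
      map_add' := fun v w => by
        ext i
        exact map_add (π i a) (v i) (w i)
      map_smul' := fun c v => by
        ext i
        exact map_smul (π i a) c (v i) }
    ‖a‖ (fun v => by
      have h2 : (0 : ℝ) < (2 : ENNReal).toReal := by simp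
      refine lp.norm_le_of_forall_sum_le h2 (by positivity) (fun s => ?_)
      calc _ ≤ ∑ i ∈ s, ‖a‖ ^ (2 : ENNReal).toReal * ‖v i‖ ^ (2 : ENNReal).toReal := by
            refine Finset.sum_le_sum (fun i _ => ?_)
            rw [← Real.mul_rpow (norm_nonneg _) (norm_nonneg _)]
            exact Real.rpow_le_rpow (norm_nonneg _) (rep_apply_norm_le (π i) a (v i)) h2.le
        _ ≤ _ := by
            rw [← Finset.mul_sum, Real.mul_rpow (norm_nonneg _) (norm_nonneg _)]
            exact mul_le_mul_of_nonneg_left (lp.sum_rpow_le_norm_rpow h2 v s) (by positivity))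

theorem directSumOp_apply (π : ∀ i, A →⋆ₐ[ℂ] (G i →L[ℂ] G i)) (a : A) (v : lp G 2) (i : ι) :
    directSumOp π a v i = π i a (v i) := rfl

/-- The direct sum of a family of representations on Hilbert spaces. -/
def directSumRep (π : ∀ i, A →⋆ₐ[ℂ] (G i →L[ℂ] G i)) : A →⋆ₐ[ℂ] (lp G 2 →L[ℂ] lp G 2) where
  toFun := directSumOp π
  map_one' := by ext v i; simp [directSumOp_apply]
  map_mul' a b := by ext v i; simp [directSumOp_apply]
  map_zero' := by ext v i; simp [directSumOp_apply]
  map_add' a b := by ext v i; simp [directSumOp_apply]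
  commutes' c := by ext v i; simp [directSumOp_apply, Algebra.algebraMap_eq_smul_one]
  map_star' a := by
    refine (ContinuousLinearMap.eq_adjoint_iff _ _).mpr (fun v w => ?_)
    rw [lp.inner_eq_tsum, lp.inner_eq_tsum]
    refine tsum_congr (fun i => ?_)
    rw [directSumOp_apply, directSumOp_apply, map_star, ContinuousLinearMap.star_eq_adjoint,
      ContinuousLinearMap.adjoint_inner_left]

end DirectSum

/-! ### States, the universal representation and the spatial tensor product -/

section CStar

/-- The state space of a unital C⋆-algebra. -/
def State (A : Type*) [CStarAlgebra A] [PartialOrder A] : Type _ :=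
  {μ : A →ₚ[ℂ] ℂ // μ 1 = 1}

variable {A : Type*} [CStarAlgebra A] [PartialOrder A] [StarOrderedRing A]

/-- The cyclic vector of the GNS representation, the class of the unit. -/
def gnsVector (μ : A →ₚ[ℂ] ℂ) : μ.GNS := ((μ.toPreGNS 1 : μ.PreGNS) : μ.GNS)

variable (A) in
/-- The Hilbert space of the universal representation: the Hilbert sum of the GNS spaces of all
states. -/
def UnivSpace : Type _ := lp (fun μ : State A => μ.1.GNS) 2

instance : NormedAddCommGroup (UnivSpace A) :=
  inferInstanceAs (NormedAddCommGroup (lp (fun μ : State A => μ.1.GNS) 2))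

instance : InnerProductSpace ℂ (UnivSpace A) :=
  inferInstanceAs (InnerProductSpace ℂ (lp (fun μ : State A => μ.1.GNS) 2))

instance : CompleteSpace (UnivSpace A) :=
  inferInstanceAs (CompleteSpace (lp (fun μ : State A => μ.1.GNS) 2))

variable (A) in
/-- The universal representation of a C⋆-algebra, the direct sum of the GNS representations of all
its states. -/
def univRep : A →⋆ₐ[ℂ] (UnivSpace A →L[ℂ] UnivSpace A) :=
  (directSumRep (fun μ : State A => μ.1.gnsStarAlgHom) :
    A →⋆ₐ[ℂ] (lp (fun μ : State A => μ.1.GNS) 2 →L[ℂ] lp (fun μ : State A => μ.1.GNS) 2))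

open Classical in
/-- The unit vector of the universal space that implements the state `μ`. -/
def stateVector (μ : State A) : UnivSpace A :=
  (lp.single 2 μ (gnsVector μ.1) : lp (fun μ : State A => μ.1.GNS) 2)

variable (A) in
/-- The spatial tensor product `A ⊗ B` of C⋆-algebras: the norm closure of the `*`-algebra generated
by the operators `a ⊗ b` on the tensor product of the universal Hilbert spaces. -/
def spatialTensor (B : Type*) [CStarAlgebra B] [PartialOrder B] [StarOrderedRing B] :
    StarSubalgebra ℂ (HilbertTensor (UnivSpace A) (UnivSpace B) →L[ℂ]
      HilbertTensor (UnivSpace A) (UnivSpace B)) :=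
  (StarAlgebra.adjoin ℂ
    {T | ∃ (a : A) (b : B), T = opTensor (univRep A a) (univRep B b)}).topologicalClosure

variable {B : Type*} [CStarAlgebra B] [PartialOrder B] [StarOrderedRing B]

instance isClosed_spatialTensor :
    IsClosed (spatialTensor A B : Set (HilbertTensor (UnivSpace A) (UnivSpace B) →L[ℂ]
      HilbertTensor (UnivSpace A) (UnivSpace B))) :=
  StarSubalgebra.isClosed_topologicalClosure _

variable (A B) in
/-- The C⋆-algebra `A ⊗ B` as a type; its order is the order of operators. -/
abbrev SpatialTensor : Type _ := spatialTensor A B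

theorem SpatialTensor.nonneg_iff (T : SpatialTensor A B) :
    0 ≤ T ↔ ∃ S : SpatialTensor A B, T = star S * S := by
  constructor
  · intro hT
    have hT' : 0 ≤ T.1 := hT
    have hsa : IsSelfAdjoint T := Subtype.ext (IsSelfAdjoint.of_nonneg hT').star_eq
    have hsp : SpectrumRestricts T ContinuousMap.realToNNReal := by
      rw [SpectrumRestricts.nnreal_iff]
      intro x hx
      refine spectrum_nonneg_of_nonneg hT' ?_
      rw [← spectrum.algebraMap_mem_iff ℂ] at hx ⊢
      rwa [StarSubalgebra.spectrum_eq (S := spatialTensor A B) (a := T)] at hx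
    obtain ⟨S, hS, -, hST⟩ := CFC.exists_sqrt_of_isSelfAdjoint_of_quasispectrumRestricts hsa hsp
    exact ⟨S, by rw [hS.star_eq, hST]⟩
  · rintro ⟨S, rfl⟩
    exact star_mul_self_nonneg S.1

instance : StarOrderedRing (SpatialTensor A B) :=
  StarOrderedRing.of_nonneg_iff' (fun h _ => add_le_add_right h _)
    SpatialTensor.nonneg_iff

/-- The product state `μ ⊗ ν` on `A ⊗ B`, the vector state given by the tensor product of the
vectors that implement `μ` and `ν`. It is determined by `(μ ⊗ ν) (a ⊗ b) = μ a * ν b`. -/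
def productState (μ : State A) (ν : State B) : SpatialTensor A B →ₚ[ℂ] ℂ :=
  PositiveLinearMap.mk₀
    { toFun := fun T =>
        ⟪vecTensor (stateVector μ) (stateVector ν),
          T.1 (vecTensor (stateVector μ) (stateVector ν))⟫_ℂ
      map_add' := fun S T => by simp
      map_smul' := fun c T => by simp }
    (fun T hT => by
      have h : 0 ≤ T.1 := hT
      exact (ContinuousLinearMap.nonneg_iff_isPositive _).mp h |>.inner_nonneg_right _)

end CStar

/-! ### Spectral measures -/

section Spectral

variable {H : Type*} [NormedAddCommGroup H] [InnerProductSpace ℂ H] [CompleteSpace H]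

/-- The positive functional `f ↦ ⟪ξ, f(T) ξ⟫` on compactly supported functions. -/
def spectralFunctional (T : H →L[ℂ] H) (ξ : H) : C_c(ℝ, ℝ) →ₚ[ℝ] ℝ :=
  PositiveLinearMap.mk₀
    { toFun := fun f => (⟪ξ, cfc (fun t : ℝ => f t) T ξ⟫_ℂ).re
      map_add' := fun f g => by
        have := cfc_add (R := ℝ) T (fun t => f t) (fun t => g t)
          (f.continuous.continuousOn) (g.continuous.continuousOn)
        simp [this]
      map_smul' := fun c f => by
        have h := cfc_smul (R := ℝ) c (fun t => f t) T (f.continuous.continuousOn)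
        have h' : cfc (fun t : ℝ => (c • f) t) T = c • cfc (fun t : ℝ => f t) T := by
          rw [← h]
          rfl
        rw [h']
        simp }
    (fun f hf => by
      have h : 0 ≤ cfc (fun t : ℝ => f t) T := cfc_nonneg (fun t _ => hf t)
      exact (Complex.nonneg_iff.mp
        (((ContinuousLinearMap.nonneg_iff_isPositive _).mp h).inner_nonneg_right ξ)).1)

/-- The spectral measure of the self-adjoint operator `T` at the vector `ξ`, i.e. the Borel measure
`G ↦ ⟪ξ, E(G) ξ⟫` where `E` is the projection-valued spectral measure of `T`: the Riesz measure of
`f ↦ ⟪ξ, f(T) ξ⟫`. -/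
def spectralMeasure (T : H →L[ℂ] H) (ξ : H) : Measure ℝ :=
  RealRMK.rieszMeasure (spectralFunctional T ξ)

/-- The distribution `P(a, μ)` of a positive element `a` in the state `μ`: the measure on `[0, ∞)`
given by the spectral measure of the image of `a` in the GNS representation of `μ`, at the cyclic
vector. -/
def distribution {A : Type*} [CStarAlgebra A] [PartialOrder A] [StarOrderedRing A]
    (a : A) (μ : A →ₚ[ℂ] ℂ) : Measure ℝ≥0 :=
  (spectralMeasure (μ.gnsStarAlgHom a) (gnsVector μ)).comap ((↑) : ℝ≥0 → ℝ)

end Spectral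

/-! ### Metric operator fields and probabilistic metrics -/

section Main

variable {X : Type*} {A : X → Type*} [∀ x, CStarAlgebra (A x)] [∀ x, PartialOrder (A x)]
  [∀ x, StarOrderedRing (A x)]

/-- `μ` is a family of metric-states for the operator field `D`. -/
def IsMetricStates (D : ∀ x x' : X, SpatialTensor (A x) (A x')) (μ : ∀ x, State (A x)) : Prop :=
  ∀ x, productState (μ x) (μ x) (D x x) = 0

/-- Metric operator fields. The triangle inequality is an inequality in the spatial tensor product
`A x ⊗ A x' ⊗ A x''`, an algebra of operators on the tensor product of the three universal spaces. -/
structure IsMetricOperatorField (D : ∀ x x' : X, SpatialTensor (A x) (A x')) : Prop where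
  exists_metricStates : ∃ μ : ∀ x, State (A x), IsMetricStates D μ
  nonneg : ∀ x x', x ≠ x' → 0 ≤ D x x'
  isUnit : ∀ x x', x ≠ x' → IsUnit (D x x')
  symm : ∀ x x', (D x x').1 = flipOp (D x' x).1
  triangle : ∀ x x' x'',
    leg13 (UnivSpace (A x')) (D x x'').1 ≤
      leg12 (UnivSpace (A x'')) (D x x').1 + leg23 (UnivSpace (A x)) (D x' x'').1

/-- Probabilistic metric spaces in the sense of Schweizer and Sklar. -/
structure IsProbabilisticMetric (P : X → X → Measure ℝ≥0) : Prop where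
  isProbabilityMeasure : ∀ x x', IsProbabilityMeasure (P x x')
  self : ∀ x, P x x = Measure.dirac 0
  ne_dirac : ∀ x x', x ≠ x' → P x x' ≠ Measure.dirac 0
  symm : ∀ x x', P x x' = P x' x
  triangle : ∀ (x x' x'' : X) (r s : ℝ≥0),
    P x x' (Set.Icc 0 r) = 1 → P x' x'' (Set.Icc 0 s) = 1 → P x x'' (Set.Icc 0 (r + s)) = 1

end Main

end MetricOperatorField

end

noncomputable section

namespace MetricOperatorField

/-! ### Elementary tensors, legs of operators, and positivity on the diagonal -/

section Tensor

variable {E F H K L : Type*}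
  [NormedAddCommGroup E] [InnerProductSpace ℂ E]
  [NormedAddCommGroup F] [InnerProductSpace ℂ F]
  [NormedAddCommGroup H] [InnerProductSpace ℂ H]
  [NormedAddCommGroup K] [InnerProductSpace ℂ K]
  [NormedAddCommGroup L] [InnerProductSpace ℂ L]

/-! The claim reduces to an ordinary metric: with `ξ_x` the unit vector of `μ_x`, each `ξ_x ⊗ ξ_x'`
is an eigenvector of `D x x'`. The eigenvalue is then the expectation `d(x, x')`, so the
distribution is the point mass at `d(x, x')`, and the axioms (i)-(iv) say that `d` is a metric.

Positivity of `D x x` (`nonneg_of_triangle`): conjugating the triangle inequality at `x, x, x` by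
the swap of the last two factors exchanges `leg12` with `leg13` and, by flip symmetry, fixes
`leg23`. Adding the two inequalities leaves `0 ≤ 2 (1 ⊗ D x x)`.

Eigenvectors (`inner_apply_left_of_triangle`, `inner_apply_right_of_triangle`): a positive operator
whose expectation at a vector vanishes kills that vector. For the points `x, x, x'` the defect of
the triangle inequality has expectation `0 + d - d = 0` at `ξ_x ⊗ ξ_x ⊗ ξ_x'`, hence kills it, which
forces `D x x' (ξ_x ⊗ ξ_x')` into `ξ_x ⊗ K`. The points `x, x', x'` force it into `H ⊗ ξ_x'`.
Together these leave only multiples of `ξ_x ⊗ ξ_x'`. -/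

theorem inner_vecTensor (v v' : H) (w w' : K) :
    ⟪vecTensor v w, vecTensor v' w'⟫_ℂ = ⟪v, v'⟫_ℂ * ⟪w, w'⟫_ℂ := by
  rw [vecTensor, vecTensor, LinearIsometry.inner_map_map, TensorProduct.inner_tmul]

theorem continuous_vecTensor : Continuous fun p : H × K => vecTensor p.1 p.2 :=
  (toHilbertTensor H K).continuous.comp TensorProduct.continuous_tmul

theorem vecTensor_add_left (v v' : H) (w : K) :
    vecTensor (v + v') w = vecTensor v w + vecTensor v' w := by
  simp [vecTensor, TensorProduct.add_tmul]

theorem vecTensor_add_right (v : H) (w w' : K) :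
    vecTensor v (w + w') = vecTensor v w + vecTensor v w' := by
  simp [vecTensor, TensorProduct.tmul_add]

/-- Elementary tensors are total: a closed condition stable under sums holds everywhere if it holds
on elementary tensors. -/
theorem HilbertTensor.induction_on {p : HilbertTensor H K → Prop} (x : HilbertTensor H K)
    (hc : IsClosed {x | p x}) (hadd : ∀ x y, p x → p y → p (x + y))
    (ht : ∀ v w, p (vecTensor v w)) : p x := by
  refine denseRange_toHilbertTensor.induction_on x hc fun t => ?_
  induction t using TensorProduct.induction_on with
  | zero => simpa [vecTensor] using ht 0 0
  | tmul v w => exact ht v w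
  | add a b ha hb => rw [map_add]; exact hadd _ _ ha hb

theorem HilbertTensor.ext_inner {x y : HilbertTensor H K}
    (h : ∀ v w, ⟪vecTensor v w, x⟫_ℂ = ⟪vecTensor v w, y⟫_ℂ) : x = y := by
  refine ext_inner_left ℂ fun z => ?_
  refine HilbertTensor.induction_on (p := fun z => ⟪z, x⟫_ℂ = ⟪z, y⟫_ℂ) z ?_ ?_ h
  · exact isClosed_eq (by fun_prop) (by fun_prop)
  · intro a b ha hb
    rw [inner_add_left, inner_add_left, ha, hb]

theorem HilbertTensor.clm_ext {S T : HilbertTensor H K →L[ℂ] E}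
    (h : ∀ v w, S (vecTensor v w) = T (vecTensor v w)) : S = T := by
  ext x
  refine HilbertTensor.induction_on (p := fun x => S x = T x) x ?_ ?_ h
  · exact isClosed_eq S.continuous T.continuous
  · intro a b ha hb
    rw [map_add, map_add, ha, hb]

/-- Two operators on a threefold tensor product agree if they agree on elementary tensors. -/
theorem HilbertTensor.clm_ext_triple {S T : HilbertTensor (HilbertTensor H K) L →L[ℂ] E}
    (h : ∀ u v w, S (vecTensor (vecTensor u v) w) = T (vecTensor (vecTensor u v) w)) : S = T := by
  refine HilbertTensor.clm_ext fun x w => ?_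
  refine HilbertTensor.induction_on
    (p := fun x => S (vecTensor x w) = T (vecTensor x w)) x ?_ ?_ fun u v => h u v w
  · have hc : Continuous fun x : HilbertTensor H K => vecTensor x w :=
      continuous_vecTensor.comp (by fun_prop : Continuous fun x : HilbertTensor H K => (x, w))
    exact isClosed_eq (S.continuous.comp hc) (T.continuous.comp hc)
  · intro a b ha hb
    rw [vecTensor_add_left, map_add, map_add, ha, hb]

theorem opTensor_vecTensor (S : H →L[ℂ] H) (T : K →L[ℂ] K) (v : H) (w : K) :
    opTensor S T (vecTensor v w) = vecTensor (S v) (T w) := by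
  change (TensorProduct.mapL S T).completion ((v ⊗ₜ[ℂ] w : H ⊗[ℂ] K) : Completion (H ⊗[ℂ] K)) = _
  rw [ContinuousLinearMap.completion_apply_coe]
  rfl

theorem hilbertCongr_toHilbertTensor (e : E ⊗[ℂ] F ≃ₗᵢ[ℂ] H ⊗[ℂ] K) (x : E ⊗[ℂ] F) :
    hilbertCongr e (toHilbertTensor E F x) = toHilbertTensor H K (e x) :=
  LinearEquiv.extendOfIsometry_eq _ _ _ _ _ _ _

theorem hilbertSwap_vecTensor (v : H) (w : K) :
    hilbertSwap H K (vecTensor v w) = vecTensor w v := by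
  rw [hilbertSwap, vecTensor, hilbertCongr_toHilbertTensor]
  rfl

theorem hilbertSwap_symm : (hilbertSwap H K).symm = hilbertSwap K H := by
  apply LinearIsometryEquiv.toContinuousLinearEquiv_injective
  apply ContinuousLinearEquiv.coe_injective
  refine HilbertTensor.clm_ext fun v w => ?_
  change (hilbertSwap H K).symm (vecTensor v w) = hilbertSwap K H (vecTensor v w)
  rw [LinearIsometryEquiv.symm_apply_eq, hilbertSwap_vecTensor, hilbertSwap_vecTensor]

theorem hilbertAssoc_vecTensor (u : H) (v : K) (w : L) :
    hilbertAssoc H K L (vecTensor (vecTensor u v) w) = vecTensor u (vecTensor v w) :=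
  LinearEquiv.extendOfIsometry_eq (TensorProduct.assoc ℂ H K L)
    (toLeftTriple H K L).toLinearMap (toRightTriple H K L).toLinearMap _ _ _
    ((u ⊗ₜ[ℂ] v) ⊗ₜ[ℂ] w)

theorem hilbertAssoc_symm_vecTensor (u : H) (v : K) (w : L) :
    (hilbertAssoc H K L).symm (vecTensor u (vecTensor v w)) = vecTensor (vecTensor u v) w := by
  rw [LinearIsometryEquiv.symm_apply_eq, hilbertAssoc_vecTensor]

theorem hilbertSwapRight_vecTensor (u : H) (v : K) (w : L) :
    hilbertSwapRight H K L (vecTensor (vecTensor u v) w) = vecTensor (vecTensor u w) v := by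
  rw [hilbertSwapRight, LinearIsometryEquiv.trans_apply, LinearIsometryEquiv.trans_apply,
    hilbertAssoc_vecTensor, vecTensor, hilbertCongr_toHilbertTensor,
    ← hilbertAssoc_symm_vecTensor, ← hilbertSwap_vecTensor v w]
  rfl

theorem hilbertSwapRight_symm : (hilbertSwapRight H K L).symm = hilbertSwapRight H L K := by
  apply LinearIsometryEquiv.toContinuousLinearEquiv_injective
  apply ContinuousLinearEquiv.coe_injective
  refine HilbertTensor.clm_ext_triple fun u v w => ?_
  change (hilbertSwapRight H K L).symm (vecTensor (vecTensor u v) w) =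
    hilbertSwapRight H L K (vecTensor (vecTensor u v) w)
  rw [LinearIsometryEquiv.symm_apply_eq, hilbertSwapRight_vecTensor, hilbertSwapRight_vecTensor]

theorem conjBy_apply (U : E ≃ₗᵢ[ℂ] F) (T : E →L[ℂ] E) (x : F) :
    conjBy U T x = U (T (U.symm x)) := rfl

theorem inner_conjBy (U : E ≃ₗᵢ[ℂ] F) (T : E →L[ℂ] E) (x y : F) :
    ⟪x, conjBy U T y⟫_ℂ = ⟪U.symm x, T (U.symm y)⟫_ℂ := by
  rw [conjBy_apply, ← U.symm.inner_map_map, U.symm_apply_apply]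

theorem flipOp_vecTensor (T : HilbertTensor H K →L[ℂ] HilbertTensor H K) (v : K) (w : H) :
    flipOp T (vecTensor v w) = hilbertSwap H K (T (vecTensor w v)) := by
  rw [flipOp, conjBy_apply, hilbertSwap_symm, hilbertSwap_vecTensor]

theorem leg12_vecTensor (T : HilbertTensor H K →L[ℂ] HilbertTensor H K) (x : HilbertTensor H K)
    (w : L) : leg12 L T (vecTensor x w) = vecTensor (T x) w :=
  opTensor_vecTensor _ _ _ _

theorem leg23_vecTensor (T : HilbertTensor K L →L[ℂ] HilbertTensor K L) (u : H) (v : K) (w : L) :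
    leg23 H T (vecTensor (vecTensor u v) w) =
      (hilbertAssoc H K L).symm (vecTensor u (T (vecTensor v w))) := by
  rw [leg23, conjBy_apply, LinearIsometryEquiv.symm_symm, hilbertAssoc_vecTensor,
    opTensor_vecTensor]
  rfl

theorem leg13_vecTensor (T : HilbertTensor H L →L[ℂ] HilbertTensor H L) (u : H) (v : K) (w : L) :
    leg13 K T (vecTensor (vecTensor u v) w) =
      hilbertSwapRight H L K (vecTensor (T (vecTensor u w)) v) := by
  rw [leg13, conjBy_apply, hilbertSwapRight_symm, hilbertSwapRight_vecTensor, leg12_vecTensor]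

/-- This and the next two formulas turn operator inequalities on the threefold product into
relations between scalars; the idle factor contributes only an inner product. -/
theorem inner_leg12 (T : HilbertTensor H K →L[ℂ] HilbertTensor H K) (u u' : H) (v v' : K)
    (w w' : L) :
    ⟪vecTensor (vecTensor u v) w, leg12 L T (vecTensor (vecTensor u' v') w')⟫_ℂ =
      ⟪vecTensor u v, T (vecTensor u' v')⟫_ℂ * ⟪w, w'⟫_ℂ := by
  rw [leg12_vecTensor, inner_vecTensor]

theorem inner_leg23 (T : HilbertTensor K L →L[ℂ] HilbertTensor K L) (u u' : H) (v v' : K)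
    (w w' : L) :
    ⟪vecTensor (vecTensor u v) w, leg23 H T (vecTensor (vecTensor u' v') w')⟫_ℂ =
      ⟪u, u'⟫_ℂ * ⟪vecTensor v w, T (vecTensor v' w')⟫_ℂ := by
  rw [leg23_vecTensor, ← (hilbertAssoc H K L).inner_map_map,
    LinearIsometryEquiv.apply_symm_apply, hilbertAssoc_vecTensor, inner_vecTensor]

theorem inner_leg13 (T : HilbertTensor H L →L[ℂ] HilbertTensor H L) (u u' : H) (v v' : K)
    (w w' : L) :
    ⟪vecTensor (vecTensor u v) w, leg13 K T (vecTensor (vecTensor u' v') w')⟫_ℂ =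
      ⟪vecTensor u w, T (vecTensor u' w')⟫_ℂ * ⟪v, v'⟫_ℂ := by
  rw [leg13_vecTensor, ← (hilbertSwapRight H L K).symm.inner_map_map,
    LinearIsometryEquiv.symm_apply_apply, hilbertSwapRight_symm, hilbertSwapRight_vecTensor,
    inner_vecTensor]

theorem conjBy_swapRight_leg13 (T : HilbertTensor H K →L[ℂ] HilbertTensor H K) :
    conjBy (hilbertSwapRight H L K) (leg13 L T) = leg12 L T := by
  refine HilbertTensor.clm_ext_triple fun u v w => ?_
  rw [conjBy_apply, hilbertSwapRight_symm, hilbertSwapRight_vecTensor, leg13_vecTensor,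
    ← hilbertSwapRight_symm, LinearIsometryEquiv.symm_apply_apply, leg12_vecTensor]

theorem conjBy_swapRight_leg23 (T : HilbertTensor L K →L[ℂ] HilbertTensor L K) :
    conjBy (hilbertSwapRight H L K) (leg23 H T) = leg23 H (flipOp T) := by
  refine HilbertTensor.clm_ext_triple fun u v w => ?_
  rw [conjBy_apply, hilbertSwapRight_symm, hilbertSwapRight_vecTensor, leg23_vecTensor,
    leg23_vecTensor, flipOp_vecTensor]
  -- The value of `T` at an elementary tensor need not be elementary, so it is generalized to an
  -- arbitrary vector; both sides are additive and continuous in it.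
  refine HilbertTensor.induction_on (p := fun x => hilbertSwapRight H L K
    ((hilbertAssoc H L K).symm (vecTensor u x)) =
      (hilbertAssoc H K L).symm (vecTensor u (hilbertSwap L K x))) _ ?_ ?_ ?_
  · have hc : Continuous fun x : HilbertTensor L K => vecTensor u x :=
      continuous_vecTensor.comp (by fun_prop : Continuous fun x : HilbertTensor L K => (u, x))
    have hc' : Continuous fun x : HilbertTensor K L => vecTensor u x :=
      continuous_vecTensor.comp (by fun_prop : Continuous fun x : HilbertTensor K L => (u, x))
    exact isClosed_eq
      ((hilbertSwapRight H L K).continuous.comp ((hilbertAssoc H L K).symm.continuous.comp hc))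
      ((hilbertAssoc H K L).symm.continuous.comp (hc'.comp (hilbertSwap L K).continuous))
  · intro a b ha hb
    simp only [vecTensor_add_right, map_add, ha, hb]
  · intro a b
    rw [hilbertAssoc_symm_vecTensor, hilbertSwapRight_vecTensor, hilbertSwap_vecTensor,
      hilbertAssoc_symm_vecTensor]

theorem conjBy_add (U : E ≃ₗᵢ[ℂ] F) (S T : E →L[ℂ] E) :
    conjBy U (S + T) = conjBy U S + conjBy U T := by
  ext x; simp [conjBy_apply]

theorem conjBy_sub (U : E ≃ₗᵢ[ℂ] F) (S T : E →L[ℂ] E) :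
    conjBy U (S - T) = conjBy U S - conjBy U T := by
  ext x; simp [conjBy_apply]

theorem conjBy_nonneg [CompleteSpace E] [CompleteSpace F] (U : E ≃ₗᵢ[ℂ] F) {T : E →L[ℂ] E}
    (hT : 0 ≤ T) : 0 ≤ conjBy U T := by
  rw [ContinuousLinearMap.nonneg_iff_isPositive,
    ContinuousLinearMap.isPositive_iff_complex] at *
  intro x
  have h : ⟪conjBy U T x, x⟫_ℂ = ⟪T (U.symm x), U.symm x⟫_ℂ := by
    rw [conjBy_apply, ← U.symm.inner_map_map, U.symm_apply_apply]
  rw [h]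
  exact hT _

theorem conjBy_mono [CompleteSpace E] [CompleteSpace F] (U : E ≃ₗᵢ[ℂ] F) {S T : E →L[ℂ] E}
    (h : S ≤ T) : conjBy U S ≤ conjBy U T := by
  rw [← sub_nonneg] at *
  rw [← conjBy_sub]
  exact conjBy_nonneg U h

/-- If `1 ⊗ T` is positive on a nonzero tensor product, then so is `T`. -/
theorem nonneg_of_leg23_nonneg [CompleteSpace H] {T : HilbertTensor K L →L[ℂ] HilbertTensor K L}
    {u : H} (hu : ‖u‖ = 1) (h : 0 ≤ leg23 H T) : 0 ≤ T := by
  have h' : 0 ≤ opTensor (ContinuousLinearMap.id ℂ H) T := by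
    have := conjBy_nonneg (hilbertAssoc H K L) h
    convert this using 1
    ext x
    simp [leg23, conjBy_apply]
  rw [ContinuousLinearMap.nonneg_iff_isPositive,
    ContinuousLinearMap.isPositive_iff_complex] at *
  intro x
  -- At `u ⊗ x` the quadratic form of `1 ⊗ T` is `‖u‖²` times that of `T` at `x`.
  have := h' (vecTensor u x)
  rwa [opTensor_vecTensor, inner_vecTensor, ContinuousLinearMap.id_apply,
    inner_self_eq_norm_sq_to_K, hu, RCLike.ofReal_one, one_pow, one_mul] at this

/-- A flip-symmetric operator that satisfies the triangle inequality is positive. -/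
theorem nonneg_of_triangle {T : HilbertTensor H H →L[ℂ] HilbertTensor H H} [CompleteSpace H]
    {u : H} (hu : ‖u‖ = 1) (hsymm : T = flipOp T) (h : leg13 H T ≤ leg12 H T + leg23 H T) :
    0 ≤ T := by
  refine nonneg_of_leg23_nonneg hu ?_
  have h' := conjBy_mono (hilbertSwapRight H H H) h
  rw [conjBy_add, conjBy_swapRight_leg13, conjBy_swapRight_leg23, ← hsymm] at h'
  -- `leg13` is by definition the conjugate of `leg12` by this swap.
  change leg12 H T ≤ leg13 H T + leg23 H T at h'
  have h2 : 0 ≤ (2 : ℝ) • leg23 H T := by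
    have := add_le_add h h'
    rw [← sub_nonneg] at this
    convert this using 1
    rw [two_smul]; abel
  have := smul_nonneg (by norm_num : (0 : ℝ) ≤ 1 / 2) h2
  rwa [smul_smul, show (1 / 2 : ℝ) * 2 = 1 by norm_num, one_smul] at this

end Tensor

/-! ### Spectral measures at eigenvectors -/

section Spectral

variable {H : Type*} [NormedAddCommGroup H] [InnerProductSpace ℂ H]

/-- The operator `l - T` kills the nonzero vector `ξ`, so it has no left inverse. -/
theorem mem_spectrum_of_apply_eq_smul {T : H →L[ℂ] H} {ξ : H} {l : ℝ} (hξ : ξ ≠ 0)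
    (h : T ξ = (l : ℂ) • ξ) : l ∈ spectrum ℝ T := by
  rw [spectrum.mem_iff]
  intro hu
  obtain ⟨S, hS⟩ := hu.exists_left_inv
  refine hξ ?_
  have h0 : (algebraMap ℝ (H →L[ℂ] H) l - T) ξ = 0 := by
    rw [sub_apply, Algebra.algebraMap_eq_smul_one, h]
    simp
  calc ξ = (S * (algebraMap ℝ (H →L[ℂ] H) l - T)) ξ := by rw [hS]; rfl
    _ = S ((algebraMap ℝ (H →L[ℂ] H) l - T) ξ) := rfl
    _ = 0 := by rw [h0, map_zero]

variable [CompleteSpace H]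

/-- The continuous functional calculus acts on eigenvectors by evaluation at the eigenvalue. -/
theorem cfc_apply_of_apply_eq_smul {T : H →L[ℂ] H} (hT : IsSelfAdjoint T) {ξ : H} {l : ℝ}
    (hξ : ξ ≠ 0) (h : T ξ = (l : ℂ) • ξ) {f : ℝ → ℝ} (hf : Continuous f) :
    cfc f T ξ = (f l : ℂ) • ξ := by
  have hl := mem_spectrum_of_apply_eq_smul hξ h
  have hcomp : CompactSpace (spectrum ℝ T) := isCompact_iff_compactSpace.mp
    (ContinuousFunctionalCalculus.isCompact_spectrum T)
  have key : ∀ g : C(spectrum ℝ T, ℝ), cfcHom hT g ξ = (g ⟨l, hl⟩ : ℂ) • ξ := by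
    intro g
    have hid : cfcHom hT (.restrict (spectrum ℝ T) <| .id ℝ) ξ = (l : ℂ) • ξ := by
      rw [cfcHom_id hT, h]
    -- Stone–Weierstrass: the good `g` contain the constants and the identity and are stable under
    -- sums, products and limits. The star of the identity is the identity again, since the scalars
    -- are real.
    refine ContinuousMap.induction_on_of_compact (s := spectrum ℝ T)
      (p := fun g => cfcHom hT g ξ = (g ⟨l, hl⟩ : ℂ) • ξ) ?_ hid ?_ ?_ ?_ ?_ g
    · intro r
      have : cfcHom hT (ContinuousMap.const _ r) = algebraMap ℝ _ r :=
        AlgHomClass.commutes (cfcHom hT) r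
      rw [this, Algebra.algebraMap_eq_smul_one]
      simp
    · exact hid
    · intro f g hf hg
      rw [map_add, add_apply, hf, hg]
      simp [add_smul]
    · intro f g hf hg
      rw [map_mul, mul_apply_eq_comp, hg, map_smul, hf]
      rw [smul_smul, ContinuousMap.mul_apply, Complex.ofReal_mul, mul_comm]
    · intro f hf
      have hc : IsClosed {g : C(spectrum ℝ T, ℝ) | cfcHom hT g ξ = (g ⟨l, hl⟩ : ℂ) • ξ} := by
        have h1 : Continuous fun g : C(spectrum ℝ T, ℝ) => cfcHom hT g ξ :=
          (cfcHom_continuous hT).clm_apply continuous_const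
        have h2 : Continuous fun g : C(spectrum ℝ T, ℝ) => (g ⟨l, hl⟩ : ℂ) • ξ :=
          (Complex.continuous_ofReal.comp (continuous_eval_const _)).smul
            continuous_const
        exact isClosed_eq h1 h2
      have := mem_closure_iff_frequently.mpr hf
      exact hc.closure_eq.subset this
  rw [cfc_apply f T hT hf.continuousOn, key]
  rfl

/-- At a unit eigenvector the functional `f ↦ ⟪ξ, f(T) ξ⟫` is evaluation at `l`, and regular
measures are determined by their integrals of compactly supported functions. -/
theorem spectralMeasure_eq_dirac {T : H →L[ℂ] H} (hT : IsSelfAdjoint T) {ξ : H} {l : ℝ}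
    (hξ : ‖ξ‖ = 1) (h : T ξ = (l : ℂ) • ξ) : spectralMeasure T ξ = Measure.dirac l := by
  have : (spectralMeasure T ξ).Regular := by unfold spectralMeasure; infer_instance
  refine Measure.ext_of_integral_eq_on_compactlySupported fun f => ?_
  rw [spectralMeasure, RealRMK.integral_rieszMeasure, integral_dirac]
  change (⟪ξ, cfc (fun t : ℝ => f t) T ξ⟫_ℂ).re = f l
  rw [cfc_apply_of_apply_eq_smul (f := fun t => f t) hT (by rintro rfl; simp at hξ) h f.continuous,
    inner_smul_right, inner_self_eq_norm_sq_to_K, hξ]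
  simp

theorem comap_coe_dirac (l : ℝ≥0) :
    (Measure.dirac (l : ℝ)).comap ((↑) : ℝ≥0 → ℝ) = Measure.dirac l := by
  have he : MeasurableEmbedding ((↑) : ℝ≥0 → ℝ) :=
    MeasurableEmbedding.subtype_coe measurableSet_Ici
  rw [← Measure.map_dirac' he.measurable, he.comap_map]

end Spectral

/-! ### From eigenvectors to distributions in the GNS representation -/

section GNS

variable {A : Type*} [CStarAlgebra A] [PartialOrder A] [StarOrderedRing A]

theorem norm_gnsVector {μ : A →ₚ[ℂ] ℂ} (h : μ 1 = 1) : ‖gnsVector μ‖ = 1 := by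
  rw [gnsVector, Completion.norm_coe, PositiveLinearMap.preGNS_norm_def]
  simp [h]

theorem norm_stateVector (μ : State A) : ‖stateVector μ‖ = 1 := by
  classical
  have := lp.norm_single (E := fun μ : State A => μ.1.GNS) (p := 2) (by norm_num) μ (gnsVector μ.1)
  rw [norm_gnsVector μ.2] at this
  convert this using 1
  rw [stateVector]
  congr!

/-- If `μ` annihilates `(a - l)⋆ (a - l)`, then the cyclic vector is an eigenvector of `a`. -/
theorem gnsStarAlgHom_gnsVector {μ : A →ₚ[ℂ] ℂ} {a : A} {l : ℂ}
    (h : μ (star (a - l • (1 : A)) * (a - l • (1 : A))) = 0) :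
    μ.gnsStarAlgHom a (gnsVector μ) = l • gnsVector μ := by
  -- For every `b`, the image of the cyclic vector under `b` has norm `√μ(b⋆ b)`; here `b = a - l`.
  have h0 : ‖μ.gnsStarAlgHom (a - l • (1 : A)) (gnsVector μ)‖ = 0 := by
    change ‖μ.gnsNonUnitalStarAlgHom _ _‖ = 0
    rw [gnsVector, PositiveLinearMap.gnsNonUnitalStarAlgHom_apply_coe, Completion.norm_coe,
      PositiveLinearMap.preGNS_norm_def, PositiveLinearMap.leftMulMapPreGNS_apply]
    change √(μ (star ((a - l • (1 : A)) * 1) * ((a - l • (1 : A)) * 1))).re = 0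
    rw [mul_one, h, Complex.zero_re, Real.sqrt_zero]
  rw [norm_eq_zero, map_sub, map_smul, map_one, sub_apply, sub_eq_zero] at h0
  exact h0

theorem distribution_eq_dirac {μ : A →ₚ[ℂ] ℂ} (hμ : μ 1 = 1) {a : A} (ha : IsSelfAdjoint a)
    {l : ℝ≥0} (h : μ (star (a - (l : ℂ) • (1 : A)) * (a - (l : ℂ) • (1 : A))) = 0) :
    distribution a μ = Measure.dirac l := by
  rw [distribution, spectralMeasure_eq_dirac (ha.map μ.gnsStarAlgHom) (norm_gnsVector hμ)
    (gnsStarAlgHom_gnsVector h), comap_coe_dirac]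

variable {B : Type*} [CStarAlgebra B] [PartialOrder B] [StarOrderedRing B]

/-- The unit vector that implements a product state. -/
def productVector (μ : State A) (ν : State B) : HilbertTensor (UnivSpace A) (UnivSpace B) :=
  vecTensor (stateVector μ) (stateVector ν)

theorem productState_apply (μ : State A) (ν : State B) (T : SpatialTensor A B) :
    productState μ ν T = ⟪productVector μ ν, T.1 (productVector μ ν)⟫_ℂ := rfl

theorem inner_productVector_self (μ : State A) (ν : State B) :
    ⟪productVector μ ν, productVector μ ν⟫_ℂ = 1 := by
  rw [productVector, inner_vecTensor, inner_self_eq_norm_sq_to_K, inner_self_eq_norm_sq_to_K,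
    norm_stateVector, norm_stateVector]
  simp

theorem productState_one (μ : State A) (ν : State B) : productState μ ν 1 = 1 := by
  rw [productState_apply]
  exact inner_productVector_self μ ν

/-- The distribution lives in the GNS space of the product state, the given eigenvector in the
tensor product of universal spaces. The scalar `(μ ⊗ ν)((T - l)⋆ (T - l))` links them: it vanishes
because `T - l` kills the product vector. -/
theorem distribution_productState {μ : State A} {ν : State B} {T : SpatialTensor A B}
    (hT : 0 ≤ T) {l : ℝ≥0}
    (h : T.1 (productVector μ ν) = (l : ℂ) • productVector μ ν) :
    distribution T (productState μ ν) = Measure.dirac l := by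
  have hT' : 0 ≤ T.1 := hT
  have hsa : IsSelfAdjoint T := Subtype.ext (IsSelfAdjoint.of_nonneg hT').star_eq
  refine distribution_eq_dirac (productState_one μ ν) hsa ?_
  rw [productState_apply]
  have h0 : (T - (l : ℂ) • (1 : SpatialTensor A B)).1 (productVector μ ν) = 0 := by
    change T.1 (productVector μ ν) - (l : ℂ) • productVector μ ν = 0
    rw [h, sub_self]
  change ⟪_, (star (T - (l : ℂ) • (1 : SpatialTensor A B))).1
    ((T - (l : ℂ) • (1 : SpatialTensor A B)).1 (productVector μ ν))⟫_ℂ = 0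
  rw [h0, map_zero, inner_zero_right]

end GNS

/-! ### Equality in the triangle inequality -/

section Eigenvector

variable {H K : Type*}
  [NormedAddCommGroup H] [InnerProductSpace ℂ H] [NormedAddCommGroup K] [InnerProductSpace ℂ K]

/-- Writing `T = S⋆ S` gives `⟪ξ, T ξ⟫ = ‖S ξ‖²`. -/
theorem apply_eq_zero_of_nonneg {H : Type*} [NormedAddCommGroup H] [InnerProductSpace ℂ H]
    [CompleteSpace H] {T : H →L[ℂ] H} (hT : 0 ≤ T) {ξ : H} (h : ⟪ξ, T ξ⟫_ℂ = 0) : T ξ = 0 := by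
  obtain ⟨S, hS⟩ := CStarAlgebra.nonneg_iff_eq_star_mul_self.mp hT
  have h1 : S ξ = 0 := by
    rw [hS, mul_apply_eq_comp, ContinuousLinearMap.star_eq_adjoint,
      ContinuousLinearMap.adjoint_inner_right, inner_self_eq_zero] at h
    exact h
  rw [hS, mul_apply_eq_comp, h1, map_zero]

/-- The triangle inequality with a repeated first point: the matrix coefficients of `T` at `u ⊗ v`
factor through `u` if the expectation of `S` vanishes at `u ⊗ u`. -/
theorem inner_apply_left_of_triangle {S : HilbertTensor H H →L[ℂ] HilbertTensor H H}
    {T : HilbertTensor H K →L[ℂ] HilbertTensor H K} {u : H} {v : K} (hu : ‖u‖ = 1)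
    (hS : 0 ≤ S) (hSu : ⟪vecTensor u u, S (vecTensor u u)⟫_ℂ = 0)
    (h : leg13 H T ≤ leg12 K S + leg23 H T) (x : H) (y : K) :
    ⟪vecTensor x y, T (vecTensor u v)⟫_ℂ = ⟪x, u⟫_ℂ * ⟪vecTensor u y, T (vecTensor u v)⟫_ℂ := by
  have huu : ⟪u, u⟫_ℂ = 1 := by rw [inner_self_eq_norm_sq_to_K, hu]; simp
  have hS0 := apply_eq_zero_of_nonneg hS hSu
  -- At `u ⊗ u ⊗ v` the term in `S` vanishes and the two terms in `T` have equal expectations.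
  have h0 := apply_eq_zero_of_nonneg (sub_nonneg.mpr h)
    (ξ := vecTensor (vecTensor u u) v) (by
      simp only [sub_apply, add_apply, inner_sub_right,
        inner_add_right, inner_leg12, inner_leg23, inner_leg13, hS0, huu, inner_zero_right]
      ring)
  -- With `u` in the middle, `leg13` yields the coefficient at `x ⊗ y` and `leg23` yields `⟪x, u⟫`
  -- times the one at `u ⊗ y`.
  have h1 := congrArg (fun z => ⟪vecTensor (vecTensor x u) y, z⟫_ℂ) h0
  simp only [sub_apply, add_apply, inner_sub_right,
    inner_add_right, inner_leg12, inner_leg23, inner_leg13, hS0, huu, inner_zero_right] at h1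
  linear_combination -h1

/-- The triangle inequality with a repeated last point: the matrix coefficients of `T` at `u ⊗ v`
factor through `v` if the expectation of `S` vanishes at `v ⊗ v`. -/
theorem inner_apply_right_of_triangle {S : HilbertTensor K K →L[ℂ] HilbertTensor K K}
    {T : HilbertTensor H K →L[ℂ] HilbertTensor H K} {u : H} {v : K} (hv : ‖v‖ = 1)
    (hS : 0 ≤ S) (hSv : ⟪vecTensor v v, S (vecTensor v v)⟫_ℂ = 0)
    (h : leg13 K T ≤ leg12 K T + leg23 H S) (x : H) (y : K) :
    ⟪vecTensor x y, T (vecTensor u v)⟫_ℂ = ⟪y, v⟫_ℂ * ⟪vecTensor x v, T (vecTensor u v)⟫_ℂ := by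
  have hvv : ⟪v, v⟫_ℂ = 1 := by rw [inner_self_eq_norm_sq_to_K, hv]; simp
  have hS0 := apply_eq_zero_of_nonneg hS hSv
  have h0 := apply_eq_zero_of_nonneg (sub_nonneg.mpr h)
    (ξ := vecTensor (vecTensor u v) v) (by
      simp only [sub_apply, add_apply, inner_sub_right,
        inner_add_right, inner_leg12, inner_leg23, inner_leg13, hS0, hvv, inner_zero_right]
      ring)
  -- Now `v` is in the middle, and `leg12` supplies the factored coefficient.
  have h1 := congrArg (fun z => ⟪vecTensor (vecTensor x v) y, z⟫_ℂ) h0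
  simp only [sub_apply, add_apply, inner_sub_right,
    inner_add_right, inner_leg12, inner_leg23, inner_leg13, hS0, hvv, inner_zero_right] at h1
  linear_combination -h1

end Eigenvector

/-! ### The metric defined by a family of metric-states -/

section Field

variable {X : Type*} {A : X → Type*} [∀ x, CStarAlgebra (A x)] [∀ x, PartialOrder (A x)]
  [∀ x, StarOrderedRing (A x)] {D : ∀ x x' : X, SpatialTensor (A x) (A x')}
  {μ : ∀ x, State (A x)}

theorem IsMetricOperatorField.nonneg_all (hD : IsMetricOperatorField D) (μ : ∀ x, State (A x))
    (x x' : X) : 0 ≤ D x x' := by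
  rcases eq_or_ne x x' with rfl | hne
  · exact nonneg_of_triangle (norm_stateVector (μ x)) (hD.symm x x) (hD.triangle x x x)
  · exact hD.nonneg x x' hne

/-- The distance of two points of a metric operator field, measured in a family of metric-states. -/
def stateDist (D : ∀ x x' : X, SpatialTensor (A x) (A x')) (μ : ∀ x, State (A x)) (x x' : X) :
    ℝ≥0 :=
  (productState (μ x) (μ x') (D x x')).re.toNNReal

/-- Positivity makes the expectation real and nonnegative, so neither the real part nor the
truncation in `stateDist` loses anything. -/
theorem IsMetricOperatorField.coe_stateDist (hD : IsMetricOperatorField D)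
    (μ : ∀ x, State (A x)) (x x' : X) :
    (stateDist D μ x x' : ℂ) = productState (μ x) (μ x') (D x x') := by
  have h := Complex.nonneg_iff.mp ((productState (μ x) (μ x')).map_nonneg (hD.nonneg_all μ x x'))
  rw [stateDist, Real.coe_toNNReal _ h.1]
  exact Complex.ext rfl h.2

/-- The vector of a product of metric-states is an eigenvector of the operator field. -/
theorem IsMetricOperatorField.apply_productVector (hD : IsMetricOperatorField D)
    (hμ : IsMetricStates D μ) (x x' : X) :
    (D x x').1 (productVector (μ x) (μ x')) =
      (stateDist D μ x x' : ℂ) • productVector (μ x) (μ x') := by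
  refine HilbertTensor.ext_inner fun v w => ?_
  -- The left lemma moves the first slot of the test vector to the vector of `μ x`, the right lemma
  -- the second slot to that of `μ x'`; the expectation remains.
  rw [hD.coe_stateDist, productState_apply, productVector,
    inner_apply_left_of_triangle (norm_stateVector (μ x)) (hD.nonneg_all μ x x) (hμ x)
      (hD.triangle x x x'),
    inner_apply_right_of_triangle (norm_stateVector (μ x')) (hD.nonneg_all μ x' x') (hμ x')
      (hD.triangle x x' x'), inner_smul_right, inner_vecTensor]
  ring

theorem IsMetricOperatorField.distribution_eq (hD : IsMetricOperatorField D)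
    (hμ : IsMetricStates D μ) (x x' : X) :
    distribution (D x x') (productState (μ x) (μ x')) = Measure.dirac (stateDist D μ x x') :=
  distribution_productState (hD.nonneg_all μ x x') (hD.apply_productVector hμ x x')

theorem IsMetricStates.stateDist_self (hμ : IsMetricStates D μ) (x : X) :
    stateDist D μ x x = 0 := by
  rw [stateDist, hμ x]; simp

/-- An invertible operator cannot have a unit vector as eigenvector with eigenvalue `0`. -/
theorem IsMetricOperatorField.stateDist_ne_zero (hD : IsMetricOperatorField D)
    (hμ : IsMetricStates D μ) {x x' : X} (hne : x ≠ x') : stateDist D μ x x' ≠ 0 := by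
  intro h0
  obtain ⟨S, hS⟩ := (hD.isUnit x x' hne).exists_left_inv
  have h := hD.apply_productVector hμ x x'
  rw [h0, NNReal.coe_zero, Complex.ofReal_zero, zero_smul] at h
  have h1 : productVector (μ x) (μ x') = 0 :=
    calc productVector (μ x) (μ x') = (S * D x x').1 (productVector (μ x) (μ x')) := by
          rw [hS]; rfl
      _ = S.1 ((D x x').1 (productVector (μ x) (μ x'))) := rfl
      _ = 0 := by rw [h, map_zero]
  have h2 := inner_productVector_self (μ x) (μ x')
  rw [h1, inner_zero_left] at h2
  exact zero_ne_one h2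

/-- The flip is conjugation by the swap unitary, which exchanges the two product vectors. -/
theorem IsMetricOperatorField.stateDist_comm (hD : IsMetricOperatorField D)
    (μ : ∀ x, State (A x)) (x x' : X) : stateDist D μ x x' = stateDist D μ x' x := by
  rw [stateDist, stateDist, productState_apply, productState_apply, hD.symm x x', flipOp,
    inner_conjBy, hilbertSwap_symm, productVector, hilbertSwap_vecTensor]
  rfl

/-- This is the expectation of the operator inequality at the tensor product of the three state
vectors; in each leg the idle unit vector contributes `1`. -/
theorem IsMetricOperatorField.stateDist_triangle (hD : IsMetricOperatorField D)
    (μ : ∀ x, State (A x)) (x x' x'' : X) :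
    stateDist D μ x x'' ≤ stateDist D μ x x' + stateDist D μ x' x'' := by
  have hu : ∀ y, ⟪stateVector (μ y), stateVector (μ y)⟫_ℂ = 1 := fun y => by
    rw [inner_self_eq_norm_sq_to_K, norm_stateVector]; simp
  have h := ((ContinuousLinearMap.nonneg_iff_isPositive _).mp
    (sub_nonneg.mpr (hD.triangle x x' x''))).inner_nonneg_right
      (vecTensor (vecTensor (stateVector (μ x)) (stateVector (μ x'))) (stateVector (μ x'')))
  simp only [sub_apply, add_apply, inner_sub_right,
    inner_add_right, inner_leg12, inner_leg23, inner_leg13, hu, one_mul, mul_one] at h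
  have h12 := hD.coe_stateDist μ x x'
  have h23 := hD.coe_stateDist μ x' x''
  have h13 := hD.coe_stateDist μ x x''
  rw [productState_apply, productVector] at h12 h23 h13
  rw [← h12, ← h23, ← h13, sub_nonneg] at h
  exact_mod_cast h

end Field

theorem dirac_Icc_eq_one_iff {l r : ℝ≥0} : Measure.dirac l (Set.Icc 0 r) = 1 ↔ l ≤ r := by
  rw [Measure.dirac_apply' _ measurableSet_Icc]
  by_cases h : l ≤ r <;> simp [h]

end MetricOperatorField

end

theorem mainTheorem6 {X : Type*} {A : X → Type*} [∀ x, CStarAlgebra (A x)]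
    [∀ x, PartialOrder (A x)] [∀ x, StarOrderedRing (A x)]
    (D : ∀ x x' : X, MetricOperatorField.SpatialTensor (A x) (A x'))
    (hD : MetricOperatorField.IsMetricOperatorField D)
    (μ : ∀ x, MetricOperatorField.State (A x))
    (hμ : MetricOperatorField.IsMetricStates D μ) :
    (∀ x x', 0 ≤ D x x') ∧
    MetricOperatorField.IsProbabilisticMetric (fun x x' =>
      MetricOperatorField.distribution (D x x')
        (MetricOperatorField.productState (μ x) (μ x'))) := by
  refine ⟨hD.nonneg_all μ, ?_⟩
  -- Every distribution becomes a point mass, and what remains are the metric axioms of `stateDist`.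
  simp only [hD.distribution_eq hμ]
  refine ⟨fun x x' => inferInstance, fun x => by rw [hμ.stateDist_self], fun x x' hne h => ?_,
    fun x x' => by rw [hD.stateDist_comm], fun x x' x'' r s hr hs => ?_⟩
  · exact hD.stateDist_ne_zero hμ hne (MeasureTheory.dirac_eq_dirac_iff.mp h)
  · rw [MetricOperatorField.dirac_Icc_eq_one_iff] at *
    exact (hD.stateDist_triangle μ x x' x'').trans (add_le_add hr hs)
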